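/- Let $X$ be a Hausdorff, path connected, locally path connected and semilocally simply connected space (every $x\in X$ has a neighbourhood $U$ with $\pi_1(U,x)\to\pi_1(X,x)$ trivial), let $p\colon\tilde X\to X$ be a covering map with $\tilde X$ simply connected, and let $\tilde x_0\in\tilde X$. Let $\pi_1(X)=\pi_1(X,p(\tilde x_0))$, with the discrete topology and with the product in which $\gamma\eta$ is the loop $\eta$ followed by $\gamma$, act on $\tilde X$ from the right by deck transformations: $\tilde x\mapsto\tilde x\gamma$ is the unique deck transformation that sends $\tilde x_0$ to the end point of the lift of $\gamma$ starting at $\tilde x_0$. Then this action is free and proper, that is, the map $\pi_1(X)\times\tilde X\to\tilde X\times\tilde X$, $(\gamma,\tilde x)\mapsto(\tilde x\gamma,\tilde x)$, is injective and proper. Let $G=(\tilde X\times\tilde X)/\pi_1(X)$ be the quotient space of the diagonal action $(x,y)\gamma=(x\gamma,y\gamma)$, viewed as a groupoid with set of objects $\tilde X/\pi_1(X)$, range $r[x,y]=x\,\pi_1(X)$, source $s[x,y]=y\,\pi_1(X)$, product $[x,y][y,w]=[x,w]$ and inverse $[x,y]^{-1}=[y,x]$. Let $\Pi_1(X)$ be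 the fundamental groupoid of $X$ (range $[\gamma]\mapsto\gamma(1)$, source $[\gamma]\mapsto\gamma(0)$), whose set of arrows carries the quotient topology of the compact-open topology on the path space $C([0,1],X)$. Then $G$ and $\Pi_1(X)$ are topological groupoids (multiplication on composable pairs and inversion are continuous), and they are isomorphic as topological groupoids: there is an isomorphism of groupoids $G\to\Pi_1(X)$ that is a homeomorphism between the spaces of arrows. -/

import Mathlib

open CategoryTheory Topology unitInterval

noncomputable section

/-! ### Semilocally simply connected spaces -/

/-- Every point `x` has a neighbourhood `U` such that `π₁(U, x) → π₁(X, x)` is trivial. -/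
def SemilocallySimplyConnected (X : Type*) [TopologicalSpace X] : Prop :=
  ∀ x : X, ∃ (U : Set X) (hx : x ∈ U), U ∈ 𝓝 x ∧
    ∀ γ : FundamentalGroup U ⟨x, hx⟩,
      FundamentalGroup.map (⟨Subtype.val, continuous_subtype_val⟩ : C(U, X)) ⟨x, hx⟩ γ = 1

/-! ### Topological groupoids

A groupoid is a small category `C` in which every arrow is invertible; its set of arrows is
`Arrow C`.  An arrow `g : a ⟶ b` has source `a` and range `b`; in the right-to-left notation the
product `g h` of arrows with `s(g) = r(h)` is `h.hom ≫ g.hom`. -/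

/-- Inversion on the set of all arrows. -/
def arrowInv (C : Type*) [Groupoid C] (g : Arrow C) : Arrow C :=
  Arrow.mk (Groupoid.inv g.hom)

/-- The fibre product of composable pairs `(g, h)`, `s(g) = r(h)`. -/
abbrev ComposablePairs (C : Type*) [Groupoid C] : Type _ :=
  {gh : Arrow C × Arrow C // gh.1.left = gh.2.right}

/-- The multiplication `(g, h) ↦ g h` on composable pairs. -/
def arrowMul (C : Type*) [Groupoid C] (gh : ComposablePairs C) : Arrow C :=
  Arrow.mk (gh.1.2.hom ≫ eqToHom gh.2.symm ≫ gh.1.1.hom)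

/-- A groupoid whose set of arrows carries a topology for which multiplication (on the fibre
product with the subspace topology) and inversion are continuous. -/
structure IsTopologicalGroupoid (C : Type*) [Groupoid C] [TopologicalSpace (Arrow C)] : Prop where
  continuous_mul : Continuous (arrowMul C)
  continuous_inv : Continuous (arrowInv C)

/-- An isomorphism of topological groupoids: a functor which is bijective on objects and a
homeomorphism on arrows. -/
structure IsTopologicalGroupoidIso {C D : Type*} [Groupoid C] [Groupoid D]
    [TopologicalSpace (Arrow C)] [TopologicalSpace (Arrow D)] (F : C ⥤ D) : Prop where
  bijective_obj : Function.Bijective F.obj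
  isHomeomorph_arrow : IsHomeomorph (fun g : Arrow C => Arrow.mk (F.map g.hom))

/-! ### The topological fundamental groupoid -/

/-- The path homotopy class of a path, as an arrow `γ 0 ⟶ γ 1` of the fundamental groupoid. -/
def pathClass {X : Type*} [TopologicalSpace X] (γ : C(I, X)) : Arrow (FundamentalGroupoid X) :=
  Arrow.mk (FundamentalGroupoid.fromPath
    (Path.Homotopic.Quotient.mk (⟨γ, rfl, rfl⟩ : Path (γ 0) (γ 1))))

/-- The arrows of the fundamental groupoid carry the quotient topology of the compact-open
topology on the path space `C(I, X)`. -/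
instance fundamentalGroupoidTopology (X : Type*) [TopologicalSpace X] :
    TopologicalSpace (Arrow (FundamentalGroupoid X)) :=
  TopologicalSpace.coinduced pathClass (inferInstance : TopologicalSpace C(I, X))

/-! ### The groupoid `(Y × Y) / H` of a free right action

A right action of `H` is an action of `Hᵐᵒᵖ`; `y h` is `MulOpposite.op h • y`. -/

/-- The action of the discrete group `H` on `Y` from the right is free and proper: the map
`H × Y → Y × Y`, `(h, y) ↦ (y h, y)` is injective and proper. -/
def IsFreeProperAction (H Y : Type*) [Group H] [TopologicalSpace Y] [MulAction Hᵐᵒᵖ Y] : Prop :=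
  letI : TopologicalSpace H := ⊥
  Function.Injective (fun z : H × Y => (MulOpposite.op z.1 • z.2, z.2)) ∧
    IsProperMap (fun z : H × Y => (MulOpposite.op z.1 • z.2, z.2))

section PairGroupoid

variable (H Y : Type*) [Group H] [MulAction Hᵐᵒᵖ Y]

/-- The quotient `(Y × Y) / H` by the diagonal action `(x, y) h = (x h, y h)`. -/
abbrev PairQuotient : Type _ := MulAction.orbitRel.Quotient Hᵐᵒᵖ (Y × Y)

/-- The orbit space `Y / H`, the set of objects of the groupoid `(Y × Y) / H`. -/
def PairGroupoid : Type _ := MulAction.orbitRel.Quotient Hᵐᵒᵖ Y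

variable {H Y}

namespace PairQuotient

/-- The class `[x, y]`. -/
def mk (H : Type*) {Y : Type*} [Group H] [MulAction Hᵐᵒᵖ Y] (x y : Y) : PairQuotient H Y :=
  Quotient.mk _ (x, y)

/-- The orbit `y H`. -/
def orb (H : Type*) {Y : Type*} [Group H] [MulAction Hᵐᵒᵖ Y] (y : Y) : PairGroupoid H Y :=
  Quotient.mk (MulAction.orbitRel Hᵐᵒᵖ Y) y

theorem mk_eq_mk {x y x' y' : Y} :
    mk H x y = mk H x' y' ↔ ∃ h : Hᵐᵒᵖ, h • x' = x ∧ h • y' = y := by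
  unfold mk
  rw [Quotient.eq, MulAction.orbitRel_apply, MulAction.mem_orbit_iff]
  simp [Prod.ext_iff]

theorem orb_eq_orb {x x' : Y} : orb H x = orb H x' ↔ ∃ h : Hᵐᵒᵖ, h • x' = x := by
  refine Iff.trans (Quotient.eq (r := MulAction.orbitRel Hᵐᵒᵖ Y)) ?_
  rw [MulAction.orbitRel_apply, MulAction.mem_orbit_iff]

theorem mk_smul (h : Hᵐᵒᵖ) (x y : Y) : mk H (h • x) (h • y) = mk H x y :=
  mk_eq_mk.2 ⟨h, rfl, rfl⟩

theorem orb_smul (h : Hᵐᵒᵖ) (x : Y) : orb H (h • x) = orb H x :=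
  orb_eq_orb.2 ⟨h, rfl⟩

theorem exists_mk (q : PairQuotient H Y) : ∃ x y, q = mk H x y := by
  induction q using Quotient.inductionOn with
  | h a => exact ⟨a.1, a.2, rfl⟩

/-- The range map `r [x, y] = x H`. -/
def range (q : PairQuotient H Y) : PairGroupoid H Y :=
  Quotient.lift (fun a : Y × Y => orb H a.1)
    (fun a b hab => by
      obtain ⟨h, hh⟩ := MulAction.mem_orbit_iff.1 (MulAction.orbitRel_apply.1 hab)
      exact orb_eq_orb.2 ⟨h, congrArg Prod.fst hh⟩) q

/-- The source map `s [x, y] = y H`. -/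
def source (q : PairQuotient H Y) : PairGroupoid H Y :=
  Quotient.lift (fun a : Y × Y => orb H a.2)
    (fun a b hab => by
      obtain ⟨h, hh⟩ := MulAction.mem_orbit_iff.1 (MulAction.orbitRel_apply.1 hab)
      exact orb_eq_orb.2 ⟨h, congrArg Prod.snd hh⟩) q

/-- The inverse `[x, y]⁻¹ = [y, x]`. -/
def inv (q : PairQuotient H Y) : PairQuotient H Y :=
  Quotient.lift (fun a : Y × Y => mk H a.2 a.1)
    (fun a b hab => by
      obtain ⟨h, hh⟩ := MulAction.mem_orbit_iff.1 (MulAction.orbitRel_apply.1 hab)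
      exact mk_eq_mk.2 ⟨h, congrArg Prod.snd hh, congrArg Prod.fst hh⟩) q

@[simp] theorem range_mk (x y : Y) : range (mk H x y) = orb H x := rfl
@[simp] theorem source_mk (x y : Y) : source (mk H x y) = orb H y := rfl
@[simp] theorem inv_mk (x y : Y) : inv (mk H x y) = mk H y x := rfl

/-- The unit `[y, y]` at `y H`. -/
def unit (a : PairGroupoid H Y) : PairQuotient H Y :=
  Quotient.lift (fun y : Y => mk H y y)
    (fun x y hxy => by
      obtain ⟨h, hh⟩ := MulAction.mem_orbit_iff.1 (MulAction.orbitRel_apply.1 hxy)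
      exact mk_eq_mk.2 ⟨h, hh, hh⟩) a

@[simp] theorem unit_orb (y : Y) : unit (orb H y) = mk H y y := rfl

/-- If `s(q) = r(q')`, then `q = [x, y]` and `q' = [y, w]` for some `x`, `y`, `w`. -/
theorem exists_rep (q q' : PairQuotient H Y) (hq : source q = range q') :
    ∃ x y w, q = mk H x y ∧ q' = mk H y w := by
  obtain ⟨x, y, rfl⟩ := exists_mk q
  obtain ⟨z, w, rfl⟩ := exists_mk q'
  obtain ⟨h, hh⟩ := orb_eq_orb.1 hq
  obtain rfl : h • z = y := hh
  exact ⟨x, h • z, h • w, rfl, (mk_smul h z w).symm⟩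

/-- The product of `q` and `q'` with `s(q) = r(q')`: it is `[x, w]` if `q = [x, y]` and
`q' = [y, w]`.  For a free action, it does not depend on `x`, `y`, `w`; see `mul_mk`. -/
def mul (q q' : PairQuotient H Y) (hq : source q = range q') : PairQuotient H Y :=
  mk H (exists_rep q q' hq).choose (exists_rep q q' hq).choose_spec.choose_spec.choose

theorem mul_mk [IsCancelSMul Hᵐᵒᵖ Y] (x y w : Y)
    (hq : source (mk H x y) = range (mk H y w)) :
    mul (mk H x y) (mk H y w) hq = mk H x w := by
  have key : ∀ x' y' w' : Y, mk H x y = mk H x' y' → mk H y w = mk H y' w' →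
      mk H x' w' = mk H x w := by
    intro x' y' w' h h'
    obtain ⟨h₁, hx, hy⟩ := mk_eq_mk.1 h
    obtain ⟨h₂, hy', hw⟩ := mk_eq_mk.1 h'
    obtain rfl : h₁ = h₂ := IsCancelSMul.right_cancel _ _ y' (hy.trans hy'.symm)
    exact (mk_eq_mk.2 ⟨h₁, hx, hw⟩).symm
  have hs := (exists_rep _ _ hq).choose_spec.choose_spec.choose_spec
  exact key _ _ _ hs.1 hs.2

end PairQuotient

open PairQuotient

/-- The groupoid `(Y × Y) / H` of a free right action: arrows `a ⟶ b` are the classes `q` with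
`s(q) = a` and `r(q) = b`. -/
instance PairGroupoid.groupoid [IsCancelSMul Hᵐᵒᵖ Y] : Groupoid (PairGroupoid H Y) where
  Hom a b := {q : PairQuotient H Y // source q = a ∧ range q = b}
  id a := ⟨unit a, by
    induction a using Quotient.inductionOn with
    | h y => exact ⟨rfl, rfl⟩⟩
  comp {a b c} f g := ⟨mul g.1 f.1 (g.2.1.trans f.2.2.symm), by
    obtain ⟨f, hfa, hfb⟩ := f
    obtain ⟨g, hgb, hgc⟩ := g
    obtain ⟨x, y, w, rfl, rfl⟩ := exists_rep g f (hgb.trans hfb.symm)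
    simp only [mul_mk]
    exact ⟨hfa, hgc⟩⟩
  inv f := ⟨PairQuotient.inv f.1, by
    obtain ⟨f, hfa, hfb⟩ := f
    obtain ⟨x, y, rfl⟩ := exists_mk f
    exact ⟨hfb, hfa⟩⟩
  id_comp := by
    rintro a b ⟨f, hfa, hfb⟩
    obtain ⟨x, y, rfl⟩ := exists_mk f
    subst hfa
    exact Subtype.ext (mul_mk x y y rfl)
  comp_id := by
    rintro a b ⟨f, hfa, hfb⟩
    obtain ⟨x, y, rfl⟩ := exists_mk f
    subst hfb
    exact Subtype.ext (mul_mk x x y rfl)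
  assoc := by
    rintro a b c d ⟨f, hfa, hfb⟩ ⟨g, hgb, hgc⟩ ⟨k, hkc, hkd⟩
    obtain ⟨x, y, w, rfl, rfl⟩ := exists_rep g f (hgb.trans hfb.symm)
    obtain ⟨u, v, rfl⟩ := exists_mk k
    obtain ⟨h, hh⟩ := orb_eq_orb.1 (hkc.trans hgc.symm)
    obtain rfl : h • x = v := hh
    refine Subtype.ext ?_
    have e₁ : mk H x y = mk H (h • x) (h • y) := (mk_smul h x y).symm
    have e₂ : mk H y w = mk H (h • y) (h • w) := (mk_smul h y w).symm
    simp only [e₁, e₂, mul_mk]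
  inv_comp := by
    rintro a b ⟨f, hfa, hfb⟩
    obtain ⟨x, y, rfl⟩ := exists_mk f
    subst hfb
    exact Subtype.ext (mul_mk x y x rfl)
  comp_inv := by
    rintro a b ⟨f, hfa, hfb⟩
    obtain ⟨x, y, rfl⟩ := exists_mk f
    subst hfa
    exact Subtype.ext (mul_mk y x y rfl)

/-- The bijection between the arrows of the groupoid and the points of `(Y × Y) / H`. -/
def PairGroupoid.arrowEquiv [IsCancelSMul Hᵐᵒᵖ Y] :
    Arrow (PairGroupoid H Y) ≃ PairQuotient H Y where
  toFun g := g.hom.1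
  invFun q := Arrow.mk (⟨q, rfl, rfl⟩ : (source q : PairGroupoid H Y) ⟶ range q)
  left_inv := by
    rintro ⟨a, b, ⟨q, ha, hb⟩⟩
    change source q = a at ha
    change range q = b at hb
    subst ha hb
    rfl
  right_inv _ := rfl

/-- The topology on the arrows is the quotient topology of `(Y × Y) / H`. -/
instance PairGroupoid.arrowTopology [TopologicalSpace Y] [IsCancelSMul Hᵐᵒᵖ Y] :
    TopologicalSpace (Arrow (PairGroupoid H Y)) :=
  TopologicalSpace.induced PairGroupoid.arrowEquiv
    (inferInstance : TopologicalSpace (PairQuotient H Y))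

end PairGroupoid

/-! ### The deck action of the fundamental group -/

section Deck

variable {X E : Type*} [TopologicalSpace X] [TopologicalSpace E] {p : E → X}

/-- The group of deck transformations of `p : E → X`. -/
def deckGroup (p : E → X) : Subgroup (E ≃ₜ E) where
  carrier := {f | ∀ e, p (f e) = p e}
  one_mem' _ := rfl
  mul_mem' {f g} hf hg e := (hf (g e)).trans (hg e)
  inv_mem' {f} hf e := by
    have h := hf (f⁻¹ e)
    rw [← h]
    exact congrArg p (f.apply_symm_apply e)

theorem deckGroup.ext_of_apply_eq [PreconnectedSpace E] (hp : IsCoveringMap p)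
    {f g : deckGroup p} (e : E) (h : f.1 e = g.1 e) : f = g := by
  have := hp.eq_of_comp_eq f.1.continuous g.1.continuous
    (funext fun a => (f.2 a).trans (g.2 a).symm) e h
  exact Subtype.ext (Homeomorph.ext fun a => congrFun this a)

theorem IsCoveringMap.locallyPathConnectedSpace_cover [LocallyPathConnectedSpace X]
    (hp : IsCoveringMap p) : LocallyPathConnectedSpace E :=
  letI : ChartedSpace X E :=
    { atlas := Set.univ
      chartAt := fun e => (hp.isLocalHomeomorph e).choose
      mem_chart_source := fun e => (hp.isLocalHomeomorph e).choose_spec.1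
      chart_mem_atlas := fun _ => trivial }
  ChartedSpace.locallyPathConnectedSpace X E

theorem IsCoveringMap.exists_deck [LocallyPathConnectedSpace X] [SimplyConnectedSpace E]
    (hp : IsCoveringMap p) {e e' : E} (h : p e' = p e) : ∃ f : deckGroup p, f.1 e = e' := by
  have := hp.locallyPathConnectedSpace_cover
  obtain ⟨F, ⟨hF, hFp⟩, -⟩ :=
    hp.existsUnique_continuousMap_lifts ⟨p, hp.continuous⟩ e e' h
  obtain ⟨G, ⟨hG, hGp⟩, -⟩ :=
    hp.existsUnique_continuousMap_lifts ⟨p, hp.continuous⟩ e' e h.symm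
  have hFp' : ∀ a, p (F a) = p a := fun a => congrFun hFp a
  have hGp' : ∀ a, p (G a) = p a := fun a => congrFun hGp a
  have h1 : (G ∘ F : E → E) = id := hp.eq_of_comp_eq (by fun_prop) continuous_id
    (funext fun a => by simp [hFp', hGp']) e (by simp [hF, hG])
  have h2 : (F ∘ G : E → E) = id := hp.eq_of_comp_eq (by fun_prop) continuous_id
    (funext fun a => by simp [hFp', hGp']) e' (by simp [hF, hG])
  exact ⟨⟨⟨⟨F, G, fun a => congrFun h1 a, fun a => congrFun h2 a⟩, F.continuous, G.continuous⟩,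
    hFp'⟩, hF⟩

/-- Deck transformations commute with path lifting. -/
theorem IsCoveringMap.deck_monodromy (hp : IsCoveringMap p) (f : deckGroup p) {x y : X}
    (γ : Path.Homotopic.Quotient x y) (e : p ⁻¹' {x}) :
    f.1 (hp.monodromy γ e).1 =
      (hp.monodromy γ ⟨f.1 e.1, (f.2 e.1).trans e.2⟩).1 := by
  obtain ⟨γ⟩ := γ
  have h0 : γ 0 = p e.1 := γ.source.trans e.2.symm
  have h0' : γ 0 = p (f.1 e.1) := h0.trans (f.2 e.1).symm
  have key : (⟨f.1, f.1.continuous⟩ : C(E, E)).comp (hp.liftPath γ e.1 h0) =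
      hp.liftPath γ (f.1 e.1) h0' := by
    refine (hp.eq_liftPath_iff' h0').mpr ⟨?_, ?_⟩
    · funext t
      exact (f.2 _).trans (congrFun (hp.liftPath_lifts γ e.1 h0) t)
    · exact congrArg f.1 (hp.liftPath_zero γ e.1 h0)
  exact congrArg (fun F : C(I, E) => F 1) key

variable [LocallyPathConnectedSpace X] [SimplyConnectedSpace E]

/-- The deck transformation of a loop `γ` at `p e₀`: the unique one which sends the base point `e₀`
to the end point of the lift of `γ` starting at `e₀`. -/
def IsCoveringMap.deckOfLoop (hp : IsCoveringMap p) (e₀ : E) (γ : FundamentalGroup X (p e₀)) :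
    deckGroup p :=
  (hp.exists_deck (e := e₀) (hp.monodromy γ.toPath ⟨e₀, rfl⟩).2).choose

theorem IsCoveringMap.deckOfLoop_apply (hp : IsCoveringMap p) (e₀ : E)
    (γ : FundamentalGroup X (p e₀)) :
    (hp.deckOfLoop e₀ γ).1 e₀ = (hp.monodromy γ.toPath ⟨e₀, rfl⟩).1 :=
  (hp.exists_deck (e := e₀) (hp.monodromy γ.toPath ⟨e₀, rfl⟩).2).choose_spec

theorem IsCoveringMap.deckOfLoop_one (hp : IsCoveringMap p) (e₀ : E) :
    hp.deckOfLoop e₀ 1 = 1 := by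
  refine deckGroup.ext_of_apply_eq hp e₀ ?_
  rw [hp.deckOfLoop_apply]
  exact congrArg Subtype.val (congrFun (hp.monodromy_refl (x := p e₀)) ⟨e₀, rfl⟩)

theorem IsCoveringMap.deckOfLoop_mul (hp : IsCoveringMap p) (e₀ : E)
    (γ η : FundamentalGroup X (p e₀)) :
    hp.deckOfLoop e₀ (γ * η) = hp.deckOfLoop e₀ η * hp.deckOfLoop e₀ γ := by
  refine deckGroup.ext_of_apply_eq hp e₀ ?_
  have h1 := hp.monodromy_trans_apply η.toPath γ.toPath ⟨e₀, rfl⟩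
  have h2 := hp.deck_monodromy (hp.deckOfLoop e₀ η) γ.toPath ⟨e₀, rfl⟩
  rw [hp.deckOfLoop_apply]
  change (hp.monodromy (η.toPath.trans γ.toPath) ⟨e₀, rfl⟩).1 =
    (hp.deckOfLoop e₀ η).1 ((hp.deckOfLoop e₀ γ).1 e₀)
  rw [h1, hp.deckOfLoop_apply e₀ γ, h2]
  congr 2
  exact Subtype.ext (hp.deckOfLoop_apply e₀ η).symm

/-- The right action of `π₁(X, p e₀)` on the simply connected covering space `E` by deck
transformations, `e γ = deckOfLoop γ e`. -/
@[reducible] def IsCoveringMap.deckAction (hp : IsCoveringMap p) (e₀ : E) :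
    MulAction (FundamentalGroup X (p e₀))ᵐᵒᵖ E where
  smul γ e := (hp.deckOfLoop e₀ γ.unop).1 e
  one_smul e := by
    change (hp.deckOfLoop e₀ 1).1 e = e
    rw [hp.deckOfLoop_one]
    rfl
  mul_smul γ η e := by
    change (hp.deckOfLoop e₀ (η.unop * γ.unop)).1 e = _
    rw [hp.deckOfLoop_mul]
    rfl

theorem IsCoveringMap.eq_one_of_monodromy (hp : IsCoveringMap p) (e₀ : E)
    (γ : FundamentalGroup X (p e₀)) (h : (hp.monodromy γ.toPath ⟨e₀, rfl⟩).1 = e₀) : γ = 1 := by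
  have h1 := hp.map_liftPathQuotient γ.toPath ⟨e₀, rfl⟩
  generalize hp.liftPathQuotient γ.toPath ⟨e₀, rfl⟩ = Γ at h1
  have h2 : hp.monodromy γ.toPath ⟨e₀, rfl⟩ = ⟨e₀, rfl⟩ := Subtype.ext h
  generalize hp.monodromy γ.toPath ⟨e₀, rfl⟩ = z at Γ h1 h2
  subst h2
  obtain rfl : Γ = Path.Homotopic.Quotient.refl e₀ := Subsingleton.elim _ _
  exact (Path.Homotopic.Quotient.cast_rfl_rfl γ.toPath).symm.trans h1.symm

/-- The deck action of the fundamental group is free. -/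
theorem IsCoveringMap.deckAction_free (hp : IsCoveringMap p) (e₀ : E) :
    letI := hp.deckAction e₀
    IsCancelSMul (FundamentalGroup X (p e₀))ᵐᵒᵖ E := by
  let _ := hp.deckAction e₀
  rw [isCancelSMul_iff_eq_one_of_smul_eq]
  intro γ e h
  have h1 : hp.deckOfLoop e₀ γ.unop = 1 := deckGroup.ext_of_apply_eq hp e h
  have h2 := hp.deckOfLoop_apply e₀ γ.unop
  rw [h1] at h2
  exact MulOpposite.unop_injective (hp.eq_one_of_monodromy e₀ γ.unop h2.symm)

end Deck

end

/-!
Write `H` for the fundamental group. Since `E` is simply connected, deck transformations act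
transitively on the fibres of `p`, and each one comes from a loop
(`IsCoveringMap.deckOfLoop_surjective`). So the orbits of the free action of `H` on `E` are exactly
the fibres of `p`.

The action is proper since `X` is Hausdorff and `p` is locally injective: the pairs in a common
fibre form a closed subset of `E × E`, on which the group element taking one entry to the other is
locally constant (`isFreeProperAction_of_fibres`). Properness gives each point of `E` a
neighbourhood disjoint from its nontrivial translates, which makes the multiplication of
`(E × E) / H` continuous (`IsFreeProperAction.isTopologicalGroupoid`).

The isomorphism sends `[x, y]` to the class of `p ∘ γ`, where `γ` is any path in `E` from `y` to
`x`; all such paths are homotopic. The topologies are compared on the path space of `E`, through the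
commutative square
```
    C(I, E)   ---->    C(I, X)
       |                  |
       v                  v
 (E × E) / H  ---->  arrows of Π₁(X)
```
The left map `γ ↦ [γ 1, γ 0]` is a quotient map because `E` is path connected and locally path
connected (`isQuotientMap_endpoints`), the top map because path lifting is continuous
(`IsCoveringMap.isQuotientMap_comp_path`), and the right one by definition. Hence the bottom map is
a quotient map; it is injective by homotopy lifting, so it is a homeomorphism
(`PairGroupoid.isTopologicalGroupoidIso`). Continuity of the operations of `Π₁(X)` is then
transported from `(E × E) / H`.
-/

/-! ### Quotient maps of path spaces -/

/-- A neighbourhood of the constant path at `y` contains all paths that stay close to `y`. -/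
theorem exists_nhds_of_mem_nhds_const {Y : Type*} [TopologicalSpace Y] (y : Y)
    {O : Set C(I, Y)} (hO : O ∈ 𝓝 (ContinuousMap.const I y)) :
    ∃ N ∈ 𝓝 y, ∀ α : C(I, Y), (∀ t, α t ∈ N) → α ∈ O := by
  have h : Filter.Tendsto id ((𝓝 y).smallSets.comap fun α : C(I, Y) => Set.range α)
      (𝓝 (ContinuousMap.const I y)) := by
    refine ContinuousMap.tendsto_nhds_compactOpen.2 fun K _ U hU hKU => ?_
    rcases K.eq_empty_or_nonempty with rfl | ⟨t, ht⟩
    · exact Filter.Eventually.of_forall fun _ => Set.mapsTo_empty _ _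
    · refine (Filter.Eventually.comap (Filter.eventually_smallSets.2
        ⟨U, hU.mem_nhds (hKU ht), fun s hs => hs⟩) _).mono fun α hα s _ => ?_
      exact hα ⟨s, rfl⟩
  obtain ⟨s, hs, hsO⟩ := Filter.mem_comap.1 (h hO)
  obtain ⟨N, hN, hNs⟩ := Filter.eventually_smallSets.1 hs
  exact ⟨N, hN, fun α hα => hsO (hNs _ (Set.range_subset_iff.2 hα))⟩

/-- The topology of `Y × Y` is the quotient topology of the path space under the end point map
`γ ↦ (γ 1, γ 0)`: the ends of a path can be moved to all nearby points by short paths. -/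
theorem isQuotientMap_endpoints (Y : Type*) [TopologicalSpace Y] [PathConnectedSpace Y]
    [LocallyPathConnectedSpace Y] :
    IsQuotientMap (fun γ : C(I, Y) => (γ 1, γ 0)) := by
  have hcont : Continuous (fun γ : C(I, Y) => (γ 1, γ 0)) := by fun_prop
  refine (isQuotientMap_iff _).2 ⟨isCoinducing_iff.2 fun S =>
    ⟨fun hS => ?_, fun hS => hS.preimage hcont⟩, ?_⟩
  swap
  · rintro ⟨x, y⟩
    exact ⟨(PathConnectedSpace.somePath y x).toContinuousMap, by simp⟩
  rw [isOpen_iff_mem_nhds]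
  rintro ⟨x, y⟩ hxy
  let γ : Path y x := PathConnectedSpace.somePath y x
  -- `T` extends `γ` by a path `α` ending at `y` and a path `β` starting at `x`. As `S` only sees
  -- end points, `T (α, β)` has its end points in `S` when `α` and `β` are constant, so also when
  -- they are short.
  let A : Type _ := {a : C(I, Y) × C(I, Y) // a.1 1 = y ∧ a.2 0 = x}
  let T : A → C(I, Y) := fun a =>
    (((⟨a.1.1, rfl, a.2.1⟩ : Path (a.1.1 0) y).trans γ).trans
      (⟨a.1.2, a.2.2, rfl⟩ : Path x (a.1.2 1))).toContinuousMap
  have hT : Continuous T := by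
    refine ContinuousMap.continuous_of_continuous_uncurry _ ?_
    refine Path.trans_continuous_family (ι := A) (fun a =>
      (⟨a.1.1, rfl, a.2.1⟩ : Path (a.1.1 0) y).trans γ) ?_
      (fun a => (⟨a.1.2, a.2.2, rfl⟩ : Path x (a.1.2 1))) ?_
    · refine Path.trans_continuous_family (ι := A) (fun a =>
        (⟨a.1.1, rfl, a.2.1⟩ : Path (a.1.1 0) y)) ?_ (fun _ => γ) ?_
      · exact (continuous_subtype_val.comp continuous_fst).fst.eval continuous_snd
      · change Continuous fun z : A × I => γ z.2
        fun_prop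
    · exact (continuous_subtype_val.comp continuous_fst).snd.eval continuous_snd
  have hT1 : ∀ a, T a 1 = a.1.2 1 := fun a => Path.target _
  have hT0 : ∀ a, T a 0 = a.1.1 0 := fun a => Path.source _
  let a₀ : A := ⟨(.const I y, .const I x), rfl, rfl⟩
  have hO : T ⁻¹' ((fun γ : C(I, Y) => (γ 1, γ 0)) ⁻¹' S) ∈ 𝓝 a₀ := by
    refine (hS.preimage hT).mem_nhds ?_
    change (T a₀ 1, T a₀ 0) ∈ S
    rw [hT1, hT0]
    exact hxy
  obtain ⟨W, hW, hWS⟩ := mem_nhds_subtype _ _ _ |>.1 hO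
  obtain ⟨O₁, hO₁, O₂, hO₂, hOW⟩ := mem_nhds_prod_iff.1 hW
  obtain ⟨N₁, hN₁, hNO₁⟩ := exists_nhds_of_mem_nhds_const y hO₁
  obtain ⟨N₂, hN₂, hNO₂⟩ := exists_nhds_of_mem_nhds_const x hO₂
  obtain ⟨M₁, ⟨hM₁, hM₁c⟩, hMN₁⟩ := (path_connected_basis y).mem_iff.1 hN₁
  obtain ⟨M₂, ⟨hM₂, hM₂c⟩, hMN₂⟩ := (path_connected_basis x).mem_iff.1 hN₂
  refine Filter.mem_of_superset (prod_mem_nhds hM₂ hM₁) ?_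
  rintro ⟨x', y'⟩ ⟨hx', hy'⟩
  obtain ⟨α, hα⟩ := hM₁c.joinedIn y' hy' y (mem_of_mem_nhds hM₁)
  obtain ⟨β, hβ⟩ := hM₂c.joinedIn x (mem_of_mem_nhds hM₂) x' hx'
  let a : A := ⟨(α.toContinuousMap, β.toContinuousMap), α.target, β.source⟩
  have ha : (T a 1, T a 0) ∈ S := hWS (a := a) (hOW
    ⟨hNO₁ _ fun t => hMN₁ (hα t), hNO₂ _ fun t => hMN₂ (hβ t)⟩)
  have e1 : T a 1 = x' := (hT1 a).trans β.target
  have e0 : T a 0 = y' := (hT0 a).trans α.source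
  rwa [e1, e0] at ha

section PathLifting

variable {X E : Type*} [TopologicalSpace X] [TopologicalSpace E] {p : E → X}

/-- A surjective covering map induces a quotient map of path spaces. Lifting is a continuous map
to the paths of `E` from the pairs of a path in `X` and a point over its start, and these pairs
project to the paths of `X` by an open surjection. -/
theorem IsCoveringMap.isQuotientMap_comp_path (hp : IsCoveringMap p)
    (hs : Function.Surjective p) :
    IsQuotientMap (fun γ : C(I, E) => (⟨p, hp.continuous⟩ : C(E, X)).comp γ) := by
  let A : Type _ := {z : C(I, X) × E // z.1 0 = p z.2}
  let L : A → C(I, E) := fun z => hp.liftPath z.1.1 z.1.2 z.2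
  have hL : Continuous L := by
    refine ContinuousMap.continuous_of_continuous_uncurry _ ?_
    let H : C(I × A, X) := ⟨fun z => z.2.1.1 z.1,
      (continuous_subtype_val.comp continuous_snd).fst.eval continuous_fst⟩
    let f : C(A, E) := ⟨fun a => a.1.2, continuous_subtype_val.snd⟩
    exact (hp.liftHomotopy H f fun a => a.2).continuous.comp continuous_swap
  have hLp : ∀ z : A, (⟨p, hp.continuous⟩ : C(E, X)).comp (L z) = z.1.1 := fun z =>
    DFunLike.coe_injective (hp.liftPath_lifts z.1.1 z.1.2 z.2)
  refine IsQuotientMap.of_comp hL (by fun_prop) ?_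
  have hfst : (fun γ : C(I, E) => (⟨p, hp.continuous⟩ : C(E, X)).comp γ) ∘ L =
      fun z => z.1.1 := funext hLp
  rw [hfst]
  refine IsOpenMap.isQuotientMap ?_ continuous_subtype_val.fst fun γ => ?_
  · refine IsOpenMap.of_nhds_le fun z => ?_
    intro S hS
    obtain ⟨W, hW, hWS⟩ := (mem_nhds_subtype _ _ _).1 (Filter.mem_map.1 hS)
    obtain ⟨V, hV, U, hU, hVU⟩ := mem_nhds_prod_iff.1 hW
    have h0 : {γ : C(I, X) | γ 0 ∈ p '' U} ∈ 𝓝 z.1.1 := by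
      have hc : Continuous fun γ : C(I, X) => γ 0 := by fun_prop
      refine hc.continuousAt ?_
      rw [z.2]
      exact hp.isLocalHomeomorph.isOpenMap.image_mem_nhds hU
    filter_upwards [hV, h0] with γ hγ hγ0
    obtain ⟨e, he, hpe⟩ := hγ0
    exact hWS (a := ⟨(γ, e), hpe.symm⟩) (hVU ⟨hγ, he⟩)
  · obtain ⟨e, he⟩ := hs (γ 0)
    exact ⟨⟨(γ, e), he.symm⟩, rfl⟩

end PathLifting

/-! ### Free and proper actions -/

section Action

variable {H Y : Type*} [Group H] [TopologicalSpace Y] [MulAction Hᵐᵒᵖ Y]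

/-- A free action whose orbits are the fibres of a local homeomorphism to a Hausdorff space is
proper. The image of `H × Y` is the closed set of pairs in a common fibre, and on it the group
element is a locally constant function of the pair. -/
theorem isFreeProperAction_of_fibres {X : Type*} [TopologicalSpace X] [T2Space X]
    [ContinuousConstSMul Hᵐᵒᵖ Y] [IsCancelSMul Hᵐᵒᵖ Y] {p : Y → X} (hp : IsLocalHomeomorph p)
    (hfib : ∀ x y : Y, p x = p y ↔ ∃ h : Hᵐᵒᵖ, h • y = x) : IsFreeProperAction H Y := by
  let _ : TopologicalSpace H := ⊥
  have _ : DiscreteTopology H := ⟨rfl⟩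
  have hinj : Function.Injective (fun z : H × Y => (MulOpposite.op z.1 • z.2, z.2)) := by
    rintro ⟨h, y⟩ ⟨h', y'⟩ e
    obtain ⟨e₁, rfl⟩ := Prod.ext_iff.1 e
    exact Prod.ext (MulOpposite.op_injective (IsCancelSMul.right_cancel _ _ _ e₁)) rfl
  refine ⟨hinj, isProperMap_of_isClosedMap_of_inj ?_ hinj fun C hC => ?_⟩
  · refine continuous_prod_of_discrete_left.2 fun h => ?_
    exact (continuous_const_smul (MulOpposite.op h)).prodMk (continuous_id (X := Y))
  refine isClosed_of_closure_subset ?_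
  rintro ⟨a, b⟩ hab
  have hpab : p a = p b := by
    have hcl : IsClosed {z : Y × Y | p z.1 = p z.2} :=
      isClosed_eq (hp.continuous.comp continuous_fst) (hp.continuous.comp continuous_snd)
    refine closure_minimal ?_ hcl hab
    rintro _ ⟨⟨h, y⟩, -, rfl⟩
    exact (hfib _ _).2 ⟨_, rfl⟩
  obtain ⟨g, rfl⟩ := (hfib a b).1 hpab
  refine ⟨(g.unop, b), ?_, rfl⟩
  -- Pairs near `(g b, b)` in the image of `C` are of the form `(g y, y)`, since `p` is injective
  -- near `g b`. So `b` is a limit point of the slice of `C` over `g`.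
  have hslice : IsClosed {y : Y | (g.unop, y) ∈ C} := hC.preimage (by fun_prop)
  refine hslice.closure_subset (mem_closure_iff.2 fun V hV hbV => ?_)
  obtain ⟨e, he, rfl⟩ := hp (g • b)
  obtain ⟨_, ⟨hW, hV', hgW⟩, ⟨⟨h, y⟩, hC, rfl⟩⟩ := mem_closure_iff.1 hab
    (e.source ×ˢ (V ∩ (g • ·) ⁻¹' e.source))
    (e.open_source.prod (hV.inter (e.open_source.preimage (continuous_const_smul g))))
    ⟨he, hbV, he⟩
  have hgh : MulOpposite.op h • y = g • y := e.injOn hW hgW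
    (((hfib _ _).2 ⟨_, rfl⟩).trans ((hfib _ _).2 ⟨_, rfl⟩).symm)
  obtain rfl : MulOpposite.op h = g := IsCancelSMul.right_cancel _ _ _ hgh
  exact ⟨y, hV', hC⟩

/-- For a free and proper action of a discrete group, every point has a neighbourhood disjoint
from its translates by nontrivial elements: the pairs `(y h, y)` with `h ≠ 1` form a closed set
that misses the diagonal. -/
theorem IsFreeProperAction.exists_nhds (hH : IsFreeProperAction H Y) (y : Y) :
    ∃ V ∈ 𝓝 y, ∀ (h : Hᵐᵒᵖ), ∀ z ∈ V, h • z ∈ V → h = 1 := by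
  let _ : TopologicalSpace H := ⊥
  have _ : DiscreteTopology H := ⟨rfl⟩
  obtain ⟨hinj, hprop⟩ := hH
  have hC : IsClosed ((fun z : H × Y => (MulOpposite.op z.1 • z.2, z.2)) ''
      ({1}ᶜ ×ˢ Set.univ)) :=
    hprop.isClosedMap _ ((isClosed_discrete _).prod isClosed_univ)
  have hy : (y, y) ∉ (fun z : H × Y => (MulOpposite.op z.1 • z.2, z.2)) ''
      ({1}ᶜ ×ˢ Set.univ) := by
    rintro ⟨⟨h, z⟩, ⟨hh, -⟩, e⟩
    have : ((h, z) : H × Y) = (1, y) := hinj (e.trans (by simp))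
    exact hh (congrArg Prod.fst this)
  obtain ⟨V₁, hV₁, V₂, hV₂, hV⟩ := mem_nhds_prod_iff.1 (hC.isOpen_compl.mem_nhds hy)
  refine ⟨V₁ ∩ V₂, Filter.inter_mem hV₁ hV₂, fun h z hz hhz => ?_⟩
  by_contra hne
  exact hV (Set.mk_mem_prod hhz.1 hz.2)
    ⟨(h.unop, z), ⟨fun h1 => hne (MulOpposite.unop_injective h1), trivial⟩, rfl⟩

open PairQuotient

omit [TopologicalSpace Y] in
theorem PairGroupoid.arrowEquiv_arrowMul [IsCancelSMul Hᵐᵒᵖ Y]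
    (c : ComposablePairs (PairGroupoid H Y)) {x y w : Y}
    (hg : PairGroupoid.arrowEquiv c.1.1 = mk H x y)
    (hh : PairGroupoid.arrowEquiv c.1.2 = mk H y w) :
    PairGroupoid.arrowEquiv (arrowMul _ c) = mk H x w := by
  obtain ⟨⟨⟨a, b, ⟨g, hga, hgb⟩⟩, ⟨a', b', ⟨h, hha, hhb⟩⟩⟩, e⟩ := c
  change a = b' at e
  subst e
  obtain rfl : g = _ := hg
  obtain rfl : h = _ := hh
  simp only [arrowMul, eqToHom_refl, Category.id_comp]
  exact mul_mk x y w (hga.trans hhb.symm)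

/-- The groupoid of a free and proper action is topological. For composable classes near `[x, y]`
and `[y, w]`, representatives near `(x, y)` and `(y, w)` share their middle entry, so the product is
near `[x, w]`. -/
theorem IsFreeProperAction.isTopologicalGroupoid [ContinuousConstSMul Hᵐᵒᵖ Y]
    [IsCancelSMul Hᵐᵒᵖ Y] (hH : IsFreeProperAction H Y) :
    IsTopologicalGroupoid (PairGroupoid H Y) where
  continuous_inv := by
    refine continuous_induced_rng.2 ?_
    have hinv : Continuous (PairQuotient.inv : PairQuotient H Y → PairQuotient H Y) :=
      Continuous.quotient_lift (continuous_quot_mk.comp continuous_swap) _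
    exact hinv.comp continuous_induced_dom
  continuous_mul := by
    refine continuous_induced_rng.2 (continuous_iff_continuousAt.2 fun c => ?_)
    have hopen : IsOpenMap (fun z : Y × Y => mk H z.1 z.2) :=
      isOpenMap_quotient_mk'_mul (Γ := Hᵐᵒᵖ) (T := Y × Y)
    have hcont : Continuous (fun z : Y × Y => mk H z.1 z.2) := continuous_quot_mk
    have hcomp : ∀ c : ComposablePairs (PairGroupoid H Y),
        source (PairGroupoid.arrowEquiv c.1.1) = range (PairGroupoid.arrowEquiv c.1.2) := fun c =>
      c.1.1.hom.2.1.trans (c.2.trans c.1.2.hom.2.2.symm)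
    obtain ⟨x, y, w, hg, hh⟩ := exists_rep _ _ (hcomp c)
    refine Filter.tendsto_def.2 fun S hS => ?_
    simp only [Function.comp_apply, PairGroupoid.arrowEquiv_arrowMul c hg hh] at hS
    obtain ⟨U, hU, W, hW, hUW⟩ := mem_nhds_prod_iff.1
      (hcont.continuousAt.preimage_mem_nhds (x := (x, w)) hS)
    obtain ⟨V, hV, hVfree⟩ := hH.exists_nhds y
    have hc₁ : Continuous fun c : ComposablePairs (PairGroupoid H Y) =>
        PairGroupoid.arrowEquiv c.1.1 :=
      continuous_induced_dom.comp (continuous_fst.comp continuous_subtype_val)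
    have hc₂ : Continuous fun c : ComposablePairs (PairGroupoid H Y) =>
        PairGroupoid.arrowEquiv c.1.2 :=
      continuous_induced_dom.comp (continuous_snd.comp continuous_subtype_val)
    have h₁ := hc₁.continuousAt.preimage_mem_nhds (x := c)
      (hg ▸ hopen.image_mem_nhds (x := (x, y)) (prod_mem_nhds hU hV))
    have h₂ := hc₂.continuousAt.preimage_mem_nhds (x := c)
      (hh ▸ hopen.image_mem_nhds (x := (y, w)) (prod_mem_nhds hV hW))
    filter_upwards [h₁, h₂] with d ⟨⟨x', y'⟩, ⟨hx', hy'⟩, hd₁⟩ ⟨⟨y'', w'⟩, ⟨hy'', hw'⟩, hd₂⟩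
    have hd := hcomp d
    change mk H x' y' = PairGroupoid.arrowEquiv d.1.1 at hd₁
    change mk H y'' w' = PairGroupoid.arrowEquiv d.1.2 at hd₂
    rw [← hd₁, ← hd₂] at hd
    -- The middle entries `y'` and `y''` lie in one orbit and both in `V`, so they agree.
    obtain ⟨h, hhy⟩ := orb_eq_orb.1 hd
    change h • y'' = y' at hhy
    subst hhy
    obtain rfl : h = 1 := hVfree h y'' hy'' hy'
    rw [one_smul] at hd₁
    change PairGroupoid.arrowEquiv (arrowMul _ d) ∈ S
    rw [PairGroupoid.arrowEquiv_arrowMul d hd₁.symm hd₂.symm]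
    exact hUW (Set.mk_mem_prod hx' hw')

end Action

/-! ### Transport along isomorphisms of groupoids -/

section Iso

variable {C D : Type*} [Groupoid C] [Groupoid D]

theorem CategoryTheory.Functor.mk_map_arrowMul (F : C ⥤ D) (c : ComposablePairs C) :
    Arrow.mk (F.map (arrowMul C c).hom) =
      arrowMul D ⟨(Arrow.mk (F.map c.1.1.hom), Arrow.mk (F.map c.1.2.hom)),
        congrArg F.obj c.2⟩ := by
  obtain ⟨⟨⟨a, b, g⟩, ⟨a', b', h⟩⟩, e⟩ := c
  change a = b' at e
  subst e
  simp [arrowMul]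

theorem CategoryTheory.Functor.mk_map_arrowInv (F : C ⥤ D) (g : Arrow C) :
    Arrow.mk (F.map (arrowInv C g).hom) = arrowInv D (Arrow.mk (F.map g.hom)) := by
  simp [arrowInv]

/-- An isomorphism of topological groupoids transports continuity of the operations. Injectivity
on objects is what makes preimages of composable arrows composable. -/
theorem IsTopologicalGroupoidIso.isTopologicalGroupoid [TopologicalSpace (Arrow C)]
    [TopologicalSpace (Arrow D)] {F : C ⥤ D} (hF : IsTopologicalGroupoidIso F)
    (hC : IsTopologicalGroupoid C) : IsTopologicalGroupoid D := by
  let Φ := hF.isHomeomorph_arrow.homeomorph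
  have hΦ : ∀ g : Arrow D, Arrow.mk (F.map (Φ.symm g).hom) = g := Φ.apply_symm_apply
  have hleft : ∀ g : Arrow D, F.obj (Φ.symm g).left = g.left := fun g =>
    congrArg Arrow.left (hΦ g)
  have hright : ∀ g : Arrow D, F.obj (Φ.symm g).right = g.right := fun g =>
    congrArg Arrow.right (hΦ g)
  constructor
  · let Ψ : ComposablePairs D → ComposablePairs C := fun c =>
      ⟨(Φ.symm c.1.1, Φ.symm c.1.2), hF.bijective_obj.1
        ((hleft c.1.1).trans (c.2.trans (hright c.1.2).symm))⟩
    have hΨ : Continuous Ψ := by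
      refine Continuous.subtype_mk ?_ _
      exact (Φ.symm.continuous.comp continuous_subtype_val.fst).prodMk
        (Φ.symm.continuous.comp continuous_subtype_val.snd)
    convert hF.isHomeomorph_arrow.continuous.comp (hC.continuous_mul.comp hΨ) using 1
    funext c
    refine Eq.trans ?_ (F.mk_map_arrowMul (Ψ c)).symm
    congr 1
    exact Subtype.ext (Prod.ext (hΦ c.1.1).symm (hΦ c.1.2).symm)
  · convert hF.isHomeomorph_arrow.continuous.comp
      (hC.continuous_inv.comp Φ.symm.continuous) using 1
    funext g
    refine Eq.trans ?_ (F.mk_map_arrowInv (Φ.symm g)).symm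
    rw [hΦ]

end Iso

/-! ### Arrows of the fundamental groupoid -/

theorem mk_fromPath_mk {X : Type*} [TopologicalSpace X] {a b : X} (γ : Path a b) :
    Arrow.mk (FundamentalGroupoid.fromPath (Path.Homotopic.Quotient.mk γ)) =
      pathClass γ.toContinuousMap := by
  obtain ⟨γ, rfl, rfl⟩ := γ
  rfl

theorem pathClass_surjective (X : Type*) [TopologicalSpace X] :
    Function.Surjective (pathClass (X := X)) := by
  rintro ⟨⟨a⟩, ⟨b⟩, f⟩
  induction f using Quotient.inductionOn with
  | h γ => exact ⟨γ.toContinuousMap, (mk_fromPath_mk γ).symm⟩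

theorem isQuotientMap_pathClass (X : Type*) [TopologicalSpace X] :
    IsQuotientMap (pathClass (X := X)) :=
  ⟨⟨rfl⟩, pathClass_surjective X⟩

/-- Arrows of the fundamental groupoid carry their end points, so equal classes mean homotopy
relative to the ends. -/
theorem homotopicRel_of_pathClass_eq {X : Type*} [TopologicalSpace X] {γ γ' : C(I, X)}
    (h : pathClass γ = pathClass γ') : γ.HomotopicRel γ' {0, 1} := by
  obtain ⟨h0, h1, e⟩ := (Arrow.mk_eq_mk_iff _ _).1 h
  have h0' : γ 0 = γ' 0 := congrArg FundamentalGroupoid.as h0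
  have h1' : γ 1 = γ' 1 := congrArg FundamentalGroupoid.as h1
  have e' := e.trans (FundamentalGroupoid.conj_eqToHom h0' h1')
  exact Path.Homotopic.Quotient.exact (e'.trans (Path.Homotopic.Quotient.mk_cast _ _ _).symm)

/-! ### The functor to the fundamental groupoid -/

section Functor

variable {H E X : Type*} [Group H] [TopologicalSpace E] [TopologicalSpace X] [MulAction Hᵐᵒᵖ E]
  [ContinuousConstSMul Hᵐᵒᵖ E] [SimplyConnectedSpace E]

open PairQuotient

/-- The image in `X` of the unique homotopy class of paths from `y` to `x` in `E`. -/
noncomputable def projectedHom (p : C(E, X)) (x y : E) :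
    (FundamentalGroupoid.map p).obj ⟨y⟩ ⟶ (FundamentalGroupoid.map p).obj ⟨x⟩ :=
  (FundamentalGroupoid.map p).map
    (FundamentalGroupoid.fromPath (.mk (PathConnectedSpace.somePath y x)))

theorem mk_projectedHom (p : C(E, X)) (γ : C(I, E)) :
    Arrow.mk (projectedHom p (γ 1) (γ 0)) = pathClass (p.comp γ) := by
  have h : (Path.Homotopic.Quotient.mk (PathConnectedSpace.somePath (γ 0) (γ 1))) =
      .mk (⟨γ, rfl, rfl⟩ : Path (γ 0) (γ 1)) := Subsingleton.elim _ _
  unfold projectedHom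
  rw [h]
  rfl

theorem projectedHom_self (p : C(E, X)) (x : E) : projectedHom p x x = 𝟙 _ := by
  rw [← (FundamentalGroupoid.map p).map_id ⟨x⟩]
  exact congrArg _ (Subsingleton.elim (α := Path.Homotopic.Quotient x x) _ _)

theorem projectedHom_comp (p : C(E, X)) (x y w : E) :
    projectedHom p y w ≫ projectedHom p x y = projectedHom p x w := by
  unfold projectedHom
  rw [← Functor.map_comp]
  exact congrArg _ (Subsingleton.elim (α := Path.Homotopic.Quotient w x) _ _)

theorem mk_projectedHom_smul {p : C(E, X)} (hp : ∀ (h : Hᵐᵒᵖ) (e : E), p (h • e) = p e)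
    (h : Hᵐᵒᵖ) (x y : E) :
    Arrow.mk (projectedHom p (h • x) (h • y)) = Arrow.mk (projectedHom p x y) := by
  obtain ⟨γ, rfl, rfl⟩ := PathConnectedSpace.somePath y x
  let δ : C(I, E) := (⟨(h • ·), continuous_const_smul h⟩ : C(E, E)).comp γ
  have hδ : p.comp δ = p.comp γ := ContinuousMap.ext fun t => hp h (γ t)
  have h₁ := mk_projectedHom p δ
  rw [hδ, ← mk_projectedHom p γ] at h₁
  exact h₁

/-- The arrow of the fundamental groupoid of `X` given by the class `[x, y]`: the image under `p`
of the class of paths from `y` to `x`. -/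
noncomputable def PairQuotient.projectedArrow {p : C(E, X)}
    (hp : ∀ (h : Hᵐᵒᵖ) (e : E), p (h • e) = p e)
    (q : PairQuotient H E) : Arrow (FundamentalGroupoid X) :=
  Quotient.lift (fun a : E × E => Arrow.mk (projectedHom p a.1 a.2))
    (fun a b hab => by
      obtain ⟨h, rfl⟩ := MulAction.mem_orbit_iff.1 (MulAction.orbitRel_apply.1 hab)
      exact mk_projectedHom_smul hp h b.1 b.2) q

/-- The map `E / H → X` induced by an `H`-invariant map `p`, on objects of the groupoids. -/
noncomputable def PairGroupoid.projectedObj {p : C(E, X)}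
    (hp : ∀ (h : Hᵐᵒᵖ) (e : E), p (h • e) = p e)
    (a : PairGroupoid H E) : FundamentalGroupoid X :=
  Quotient.lift (fun y : E => (⟨p y⟩ : FundamentalGroupoid X))
    (fun a b hab => by
      obtain ⟨h, rfl⟩ := MulAction.mem_orbit_iff.1 (MulAction.orbitRel_apply.1 hab)
      exact congrArg FundamentalGroupoid.mk (hp h b)) a

theorem PairQuotient.projectedArrow_left {p : C(E, X)}
    (hp : ∀ (h : Hᵐᵒᵖ) (e : E), p (h • e) = p e) (q : PairQuotient H E) :
    (q.projectedArrow hp).left = PairGroupoid.projectedObj hp (source q) := by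
  obtain ⟨x, y, rfl⟩ := exists_mk q
  rfl

theorem PairQuotient.projectedArrow_right {p : C(E, X)}
    (hp : ∀ (h : Hᵐᵒᵖ) (e : E), p (h • e) = p e) (q : PairQuotient H E) :
    (q.projectedArrow hp).right = PairGroupoid.projectedObj hp (range q) := by
  obtain ⟨x, y, rfl⟩ := exists_mk q
  rfl

/-- The class `[x, y]` as an arrow of the groupoid from `y H` to `x H`. -/
noncomputable def PairGroupoid.homMk (H : Type*) {Y : Type*} [Group H] [MulAction Hᵐᵒᵖ Y]
    [IsCancelSMul Hᵐᵒᵖ Y] (x y : Y) : orb H y ⟶ orb H x :=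
  ⟨mk H x y, rfl, rfl⟩

theorem PairGroupoid.homMk_comp_homMk (H : Type*) {Y : Type*} [Group H] [MulAction Hᵐᵒᵖ Y]
    [IsCancelSMul Hᵐᵒᵖ Y] (x y w : Y) : homMk H y w ≫ homMk H x y = homMk H x w :=
  Subtype.ext (mul_mk x y w rfl)

/-- The arrow `f.1.projectedArrow hp`, with its end points rewritten as the images of those of
`f`; they agree, but not by definition. -/
noncomputable def PairGroupoid.projectedMap [IsCancelSMul Hᵐᵒᵖ E] {p : C(E, X)}
    (hp : ∀ (h : Hᵐᵒᵖ) (e : E), p (h • e) = p e) {a b : PairGroupoid H E} (f : a ⟶ b) :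
    PairGroupoid.projectedObj hp a ⟶ PairGroupoid.projectedObj hp b :=
  eqToHom ((congrArg _ f.2.1.symm).trans (f.1.projectedArrow_left hp).symm) ≫
    (f.1.projectedArrow hp).hom ≫
    eqToHom ((f.1.projectedArrow_right hp).trans (congrArg _ f.2.2))

theorem PairGroupoid.projectedMap_homMk [IsCancelSMul Hᵐᵒᵖ E] {p : C(E, X)}
    (hp : ∀ (h : Hᵐᵒᵖ) (e : E), p (h • e) = p e) (x y : E) :
    PairGroupoid.projectedMap hp (homMk H x y) = projectedHom p x y := by
  unfold PairGroupoid.projectedMap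
  exact (Category.id_comp _).trans (Category.comp_id _)

/-- The functor from `(E × E) / H` to the fundamental groupoid of `X` induced by an `H`-invariant
map `p`; it sends `[x, y]` to the image of the class of paths from `y` to `x`. -/
noncomputable def PairGroupoid.toFundamentalGroupoid [IsCancelSMul Hᵐᵒᵖ E] {p : C(E, X)}
    (hp : ∀ (h : Hᵐᵒᵖ) (e : E), p (h • e) = p e) : PairGroupoid H E ⥤ FundamentalGroupoid X where
  obj := PairGroupoid.projectedObj hp
  map f := PairGroupoid.projectedMap hp f
  map_id a := by
    induction a using Quotient.inductionOn with
    | h y => exact (projectedMap_homMk hp y y).trans (projectedHom_self p y)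
  map_comp {a b c} f g := by
    obtain ⟨f, hfa, hfb⟩ := f
    obtain ⟨g, hgb, hgc⟩ := g
    obtain ⟨x, y, w, rfl, rfl⟩ := exists_rep g f (hgb.trans hfb.symm)
    subst hfa hgb hgc
    refine (congrArg (projectedMap hp) (homMk_comp_homMk H x y w)).trans
      ((projectedMap_homMk hp x w).trans ?_)
    rw [← projectedHom_comp p x y w, ← projectedMap_homMk hp x y, ← projectedMap_homMk hp y w]
    rfl

theorem PairGroupoid.mk_toFundamentalGroupoid_map [IsCancelSMul Hᵐᵒᵖ E] {p : C(E, X)}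
    (hp : ∀ (h : Hᵐᵒᵖ) (e : E), p (h • e) = p e) (g : Arrow (PairGroupoid H E)) (γ : C(I, E))
    (hg : arrowEquiv g = mk H (γ 1) (γ 0)) :
    Arrow.mk ((toFundamentalGroupoid hp).map g.hom) = pathClass (p.comp γ) := by
  rw [← mk_projectedHom]
  obtain rfl : arrowEquiv.symm (mk H (γ 1) (γ 0)) = g := (Equiv.symm_apply_eq _).2 hg.symm
  exact congrArg Arrow.mk (projectedMap_homMk hp _ _)

/-- If `p` is a surjective covering map whose fibres are the orbits, the induced functor is an
isomorphism of topological groupoids. Both arrow spaces are quotients of the space of paths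
in `E`, compatibly with the functor, so it is a quotient map on arrows. It is injective there
because homotopic paths have lifts with the same end points. -/
theorem PairGroupoid.isTopologicalGroupoidIso [IsCancelSMul Hᵐᵒᵖ E] [LocallyPathConnectedSpace E]
    {p : C(E, X)} (hp : IsCoveringMap p) (hs : Function.Surjective p)
    (hfib : ∀ x y : E, p x = p y ↔ ∃ h : Hᵐᵒᵖ, h • y = x) :
    IsTopologicalGroupoidIso
      (toFundamentalGroupoid (p := p) fun (h : Hᵐᵒᵖ) _ => (hfib _ _).2 ⟨h, rfl⟩) where
  bijective_obj := by
    constructor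
    · intro a b hab
      induction a using Quotient.inductionOn with
      | h x =>
        induction b using Quotient.inductionOn with
        | h y =>
          exact orb_eq_orb.2 ((hfib x y).1 (congrArg FundamentalGroupoid.as hab))
    · rintro ⟨x⟩
      obtain ⟨e, rfl⟩ := hs x
      exact ⟨orb H e, rfl⟩
  isHomeomorph_arrow := by
    have hp' : ∀ (h : Hᵐᵒᵖ) (e : E), p (h • e) = p e := fun h e => (hfib _ _).2 ⟨h, rfl⟩
    let Q : C(I, E) → Arrow (PairGroupoid H E) := fun γ => arrowEquiv.symm (mk H (γ 1) (γ 0))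
    have hQ : IsQuotientMap Q := by
      have h₁ : IsQuotientMap (fun z : E × E => mk H z.1 z.2) := isQuotientMap_quot_mk
      let e : PairQuotient H E ≃ₜ Arrow (PairGroupoid H E) :=
        (arrowEquiv.toHomeomorphOfIsInducing ⟨rfl⟩).symm
      exact e.isQuotientMap.comp (h₁.comp (isQuotientMap_endpoints E))
    have hcomp : (fun g : Arrow (PairGroupoid H E) =>
        Arrow.mk ((toFundamentalGroupoid hp').map g.hom)) ∘ Q = fun γ => pathClass (p.comp γ) :=
      funext fun γ => mk_toFundamentalGroupoid_map hp' _ γ rfl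
    have hquot : IsQuotientMap (fun γ : C(I, E) => pathClass (p.comp γ)) :=
      (isQuotientMap_pathClass X).comp (hp.isQuotientMap_comp_path hs)
    refine isHomeomorph_iff_isQuotientMap_injective.2 ⟨?_, ?_⟩
    · rw [← hcomp] at hquot
      exact hquot.of_comp hQ.continuous (hQ.continuous_iff.2 hquot.continuous)
    · intro g g' hgg
      obtain ⟨γ, rfl⟩ := hQ.surjective g
      obtain ⟨γ', rfl⟩ := hQ.surjective g'
      have hcl : pathClass (p.comp γ) = pathClass (p.comp γ') :=
        (congrFun hcomp γ).symm.trans (hgg.trans (congrFun hcomp γ'))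
      have hrel := homotopicRel_of_pathClass_eq hcl
      have h0 : p (γ 0) = p (γ' 0) := hrel.some.eq_fst 0 (.inl rfl) |>.symm.trans
         (hrel.some.eq_snd 0 (.inl rfl))
      obtain ⟨h, hh⟩ := (hfib _ _).1 h0
      -- The translate of `γ'` that starts where `γ` does.
      let δ : C(I, E) := (⟨(h • ·), continuous_const_smul h⟩ : C(E, E)).comp γ'
      have hδ : p ∘ δ = p.comp γ' := funext fun t => hp' h _
      have h1 := hp.liftPath_apply_one_eq_of_homotopicRel hrel (γ 0) rfl h0.symm
      rw [← (hp.eq_liftPath_iff' (Γ := γ) _).2 ⟨rfl, rfl⟩,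
        ← (hp.eq_liftPath_iff' (Γ := δ) _).2 ⟨hδ, hh⟩] at h1
      exact congrArg arrowEquiv.symm (mk_eq_mk.2 ⟨h, h1.symm, hh⟩)

end Functor

/-! ### Orbits of the deck action -/

section DeckAction

variable {X E : Type*} [TopologicalSpace X] [TopologicalSpace E] {p : E → X}

theorem IsCoveringMap.surjective [PathConnectedSpace X] [Nonempty E] (hp : IsCoveringMap p) :
    Function.Surjective p := by
  intro x
  obtain ⟨e⟩ := ‹Nonempty E›
  let γ := PathConnectedSpace.somePath (p e) x
  exact ⟨hp.liftPath γ e γ.source 1, (congrFun (hp.liftPath_lifts γ e γ.source) 1).trans γ.target⟩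

variable [LocallyPathConnectedSpace X] [SimplyConnectedSpace E]

/-- Every deck transformation `f` comes from a loop, the image of a path from `e₀` to `f e₀`. -/
theorem IsCoveringMap.deckOfLoop_surjective (hp : IsCoveringMap p) (e₀ : E) :
    Function.Surjective (hp.deckOfLoop e₀) := by
  intro f
  let Γ : Path.Homotopic.Quotient e₀ (f.1 e₀) := .mk (PathConnectedSpace.somePath _ _)
  let γ : Path.Homotopic.Quotient (p e₀) (p e₀) :=
    (Γ.map ⟨p, hp.continuous⟩).cast rfl (f.2 e₀).symm
  refine ⟨FundamentalGroup.fromPath γ, deckGroup.ext_of_apply_eq hp e₀ ?_⟩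
  rw [hp.deckOfLoop_apply]
  have h := hp.monodromy_eq_of_map_eq (γ := γ) (ex := ⟨e₀, rfl⟩) (ey := ⟨f.1 e₀, f.2 e₀⟩) Γ
    (((Γ.map _).cast_cast _ _ _ _).trans (Γ.map _).cast_rfl_rfl).symm
  exact congrArg Subtype.val h

theorem IsCoveringMap.deckAction_continuousConstSMul (hp : IsCoveringMap p) (e₀ : E) :
    letI := hp.deckAction e₀
    ContinuousConstSMul (FundamentalGroup X (p e₀))ᵐᵒᵖ E :=
  letI := hp.deckAction e₀
  ⟨fun γ => (hp.deckOfLoop e₀ γ.unop).1.continuous⟩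

theorem IsCoveringMap.apply_eq_apply_iff_exists_smul (hp : IsCoveringMap p) (e₀ x y : E) :
    letI := hp.deckAction e₀
    p x = p y ↔ ∃ γ : (FundamentalGroup X (p e₀))ᵐᵒᵖ, γ • y = x := by
  let _ := hp.deckAction e₀
  constructor
  · intro h
    obtain ⟨f, hf⟩ := hp.exists_deck h
    obtain ⟨γ, rfl⟩ := hp.deckOfLoop_surjective e₀ f
    exact ⟨MulOpposite.op γ, hf⟩
  · rintro ⟨γ, rfl⟩
    exact (hp.deckOfLoop e₀ γ.unop).2 y

end DeckAction

theorem mainTheorem5 {X E : Type*} [TopologicalSpace X] [TopologicalSpace E]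
    [T2Space X] [PathConnectedSpace X] [LocallyPathConnectedSpace X]
    (hX : SemilocallySimplyConnected X)
    [SimplyConnectedSpace E] {p : E → X} (hp : IsCoveringMap p) (e₀ : E) :
    letI := hp.deckAction e₀
    haveI := hp.deckAction_free e₀
    IsFreeProperAction (FundamentalGroup X (p e₀)) E ∧
      IsTopologicalGroupoid (PairGroupoid (FundamentalGroup X (p e₀)) E) ∧
      IsTopologicalGroupoid (FundamentalGroupoid X) ∧
      ∃ F : PairGroupoid (FundamentalGroup X (p e₀)) E ⥤ FundamentalGroupoid X,
        IsTopologicalGroupoidIso F := by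
  let _ := hp.deckAction e₀
  have _ := hp.deckAction_free e₀
  have _ := hp.deckAction_continuousConstSMul e₀
  have _ := hp.locallyPathConnectedSpace_cover
  have hfib := hp.apply_eq_apply_iff_exists_smul e₀
  have hfree := isFreeProperAction_of_fibres hp.isLocalHomeomorph hfib
  have hG := hfree.isTopologicalGroupoid
  have hF := PairGroupoid.isTopologicalGroupoidIso (p := ⟨p, hp.continuous⟩) hp hp.surjective hfib
  exact ⟨hfree, hG, hF.isTopologicalGroupoid hG, _, hF⟩
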